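/- Let $q$ be an odd prime power, $m\ge 1$ and $0\le t\le m$ integers, and $\delta\in\mathbb F_q^*$. For integers $r$ and $n\ge 0$ let $s(r,n)$ be the number of symmetric $n\times n$ matrices over $\mathbb F_q$ of rank exactly $r$, and let $n_s(r,n)$ be the number of those of rank at most $r$ (so both are $0$ for $r<0$, $s(r,n)=0$ for $r>n$, and the only $0\times 0$ matrix has rank $0$). Let $\mathbb S(t,m)$ be the set of symmetric $m\times m$ matrices over $\mathbb F_q$ of rank at most $t$, and let $\widehat C_{symm}(t,m)\subseteq\mathbb F_q^{\mathbb S(t,m)}$ be the linear code consisting of all tuples $(f(A))_{A\in\mathbb S(t,m)}$, where $f$ runs through the homogeneous linear polynomials over $\mathbb F_q$ in the $m^2$ variables $X_{ij}$, $1\le i,j\le m$. Let $W_1^\delta(t,m)=|\{A\in\mathbb S(t,m): \delta A_{11}\ne 0\}|$. Then the codeword of $\widehat C_{symm}(t,m)$ given by $f_1^\delta=\delta X_{11}$ has Hamming weight $W_1^\delta(t,m)$, and $$W_1^\delta(t,m)=\begin{cases}(q-1)q^{m-1}n_s(t-2,m-1)+(q-1)q^{t-1}s(t-1,m-1)+(q-1)q^{t-1}s(t,m-1),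 & t\text{ odd},\\[4pt] (q-1)q^{m-1}n_s(t-2,m-1)+(q-1)q^{t-1}s(t-1,m-1)+(q-1)\left(q^{t-1}-q^{-1}\right)s(t,m-1), & t\text{ even}.\end{cases}$$ -/

import Mathlib

/-!
Codes obtained by evaluating linear forms at the symmetric matrices of bounded rank over a
finite field `F`.  Ranks are compared in `ℤ`, so that counts with a negative rank (bound) are
literally counts of an empty set.
-/

namespace SymmDetCode

open MvPolynomial

section

variable (F : Type*) [Field F]

/-- The set of symmetric `m × m` matrices over `F` of rank at most `t`. -/
def rankLE (t : ℤ) (m : ℕ) : Set (Matrix (Fin m) (Fin m) F) :=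
  {A | A.IsSymm ∧ (A.rank : ℤ) ≤ t}

/-- The set of symmetric `m × m` matrices over `F` of rank exactly `r`. -/
def rankEq (r : ℤ) (m : ℕ) : Set (Matrix (Fin m) (Fin m) F) :=
  {A | A.IsSymm ∧ (A.rank : ℤ) = r}

/-- `n_s(t, m)`: the number of symmetric `m × m` matrices of rank at most `t`. -/
noncomputable def nS (t : ℤ) (m : ℕ) : ℕ := (rankLE F t m).ncard

/-- `s(r, m)`: the number of symmetric `m × m` matrices of rank `r`. -/
noncomputable def s (r : ℤ) (m : ℕ) : ℕ := (rankEq F r m).ncard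

/-- The space `F[X]₁` of homogeneous linear polynomials in the `m ^ 2` variables `X i j`. -/
abbrev LinForm (m : ℕ) : Submodule F (MvPolynomial (Fin m × Fin m) F) :=
  homogeneousSubmodule (Fin m × Fin m) F 1

/-- The evaluation map sending a linear form to the tuple of its values at all symmetric
matrices of rank at most `t`. -/
noncomputable def evalMap (t : ℤ) (m : ℕ) : LinForm F m →ₗ[F] (rankLE F t m → F) where
  toFun f := fun A => eval (fun p : Fin m × Fin m => A.1 p.1 p.2) f.1
  map_add' f g := by ext A; simp
  map_smul' c f := by ext A; simp [smul_eval]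

/-- The affine symmetric determinantal code: the image of the evaluation map. -/
noncomputable def code (t : ℤ) (m : ℕ) : Submodule F (rankLE F t m → F) :=
  LinearMap.range (evalMap F t m)

noncomputable instance instFintypeRankLE [Finite F] (t : ℤ) (m : ℕ) :
    Fintype (rankLE F t m) := Fintype.ofFinite _

end

section

variable {F : Type*} [Field F]

/-- The polynomial `X 1 1 + ⋯ + X (k-1) (k-1) + δ * X k k` with 1-based indices (the `i : Fin m`
of Lean is the index `i + 1`); it is `0` for `k = 0`. -/
noncomputable def diagPoly (k : ℕ) (δ : F) (m : ℕ) : MvPolynomial (Fin m × Fin m) F :=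
  ∑ i : Fin m, if (i : ℕ) + 1 < k then X (i, i)
    else if (i : ℕ) + 1 = k then C δ * X (i, i) else 0

theorem diagPoly_mem (k : ℕ) (δ : F) (m : ℕ) : diagPoly k δ m ∈ LinForm F m := by
  refine Submodule.sum_mem _ fun i _ => ?_
  split_ifs
  · exact isHomogeneous_X F (i, i)
  · rw [← smul_eq_C_mul]
    exact Submodule.smul_mem _ _ (isHomogeneous_X F (i, i))
  · exact Submodule.zero_mem _

/-- The linear form `f_k^δ`. -/
noncomputable def diagForm (k : ℕ) (δ : F) (m : ℕ) : LinForm F m :=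
  ⟨diagPoly k δ m, diagPoly_mem k δ m⟩

/-- The codeword of `f_k^δ`, as an element of the code. -/
noncomputable def codeword (k : ℕ) (δ : F) (t : ℤ) (m : ℕ) : code F t m :=
  ⟨evalMap F t m (diagForm k δ m), LinearMap.mem_range_self _ _⟩

/-- `Supp_t(f_k^δ)`: the symmetric matrices of rank at most `t` at which `f_k^δ` does not
vanish. -/
def supp (k : ℕ) (δ : F) (t : ℤ) (m : ℕ) : Set (Matrix (Fin m) (Fin m) F) :=
  {A | A ∈ rankLE F t m ∧
    eval (fun p : Fin m × Fin m => A p.1 p.2) (diagForm k δ m).1 ≠ 0}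

/-- `W_k^δ(t, m)`: the cardinality of `Supp_t(f_k^δ)`. -/
noncomputable def W (k : ℕ) (δ : F) (t : ℤ) (m : ℕ) : ℕ := (supp k δ t m).ncard

end

end SymmDetCode

namespace SymmDetCode

open Matrix

/-! ### Ranks of bordered symmetric matrices. -/

section Border

variable {ι κ F : Type*} [Fintype ι] [Fintype κ] [Field F]

/-! Write `m = n + 1` and split off the first row and column `(a, v)` of a symmetric matrix. When `a
≠ 0`, elimination lowers the rank by one and translates the remaining block by a matrix depending
only on `a` and `v`, so the weight is `(q - 1) q ^ n n_s(t - 1, n)` (`sum_corner_ne_zero`). Since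
`n_s(t - 1, n) = n_s(t - 2, n) + s(t - 1, n)`, the claim reduces to the relation between `s(t - 1,
n)` and `s(t, n)` in `s_ratio`. That follows by induction on `n` from the recurrence `s_succ`, which
counts the ways to border a block of given rank. -/

open Classical in
theorem rank_fromRows_singleton (w : κ → F) (M : Matrix ι κ F) :
    (fromRows (of fun _ : Unit => w) M).rank =
      M.rank + if w ∈ LinearMap.range Mᵀ.mulVecLin then 0 else 1 := by
  have hrange : Set.range (fromRows (of fun _ : Unit => w) M).row =
      insert w (Set.range M.row) := by
    ext x
    constructor
    · rintro ⟨i | i, rfl⟩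
      · exact Or.inl rfl
      · exact Or.inr ⟨i, rfl⟩
    · rintro (rfl | ⟨i, rfl⟩)
      · exact ⟨Sum.inl (), rfl⟩
      · exact ⟨Sum.inr i, rfl⟩
  rw [rank_eq_finrank_span_row, rank_eq_finrank_span_row, hrange, range_mulVecLin, col_transpose]
  split_ifs with h
  · rw [Submodule.span_insert_eq_span h, add_zero]
  · rw [Submodule.span_insert, sup_comm, Submodule.finrank_sup_span_singleton h]

open Classical in
theorem rank_fromCols_singleton (w : ι → F) (M : Matrix ι κ F) :
    (fromCols (of fun i (_ : Unit) => w i) M).rank =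
      M.rank + if w ∈ LinearMap.range M.mulVecLin then 0 else 1 := by
  rw [← rank_transpose, transpose_fromCols]
  have h := rank_fromRows_singleton w Mᵀ
  rw [transpose_transpose, rank_transpose] at h
  exact h

/-- The square matrix with corner entry `a`, first row and column continued by `v`, and
remaining block `B`. -/
def border (a : F) (v : ι → F) (B : Matrix ι ι F) : Matrix (Unit ⊕ ι) (Unit ⊕ ι) F :=
  fromBlocks (of fun _ _ => a) (of fun _ j => v j) (of fun i _ => v i) B

-- Adjoin the column `v` to `B`, then the row `(a, v)` on top. Each step raises the rank unless the
-- new vector already lies in the span; for the row, symmetry of `B` turns this into solvability of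
-- `B x = v`, `x ⬝ᵥ v = a`.
open Classical in
theorem rank_border (a : F) (v : ι → F) {B : Matrix ι ι F} (hB : B.IsSymm) :
    (border a v B).rank = B.rank + (if v ∈ LinearMap.range B.mulVecLin then 0 else 1) +
      if ∃ x, B *ᵥ x = v ∧ x ⬝ᵥ v = a then 0 else 1 := by
  have hrow : border a v B = fromRows (of fun _ : Unit => (Sum.elim (fun _ => a) v))
      (fromCols (of fun i (_ : Unit) => v i) B) := by
    ext (i | i) (j | j) <;> rfl
  rw [hrow, rank_fromRows_singleton, rank_fromCols_singleton]
  congr 2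
  refine propext (exists_congr fun x => ?_)
  rw [mulVecLin_apply, transpose_fromCols, fromRows_mulVec, hB.eq]
  constructor
  · intro h
    refine ⟨funext fun i => congrFun h (Sum.inr i), ?_⟩
    have := congrFun h (Sum.inl ())
    simpa [mulVec, dotProduct_comm] using this
  · rintro ⟨h, h'⟩
    ext i
    rcases i with i | i
    · simpa [mulVec, dotProduct_comm] using h'
    · exact congrFun h i

theorem rank_border_of_notMem (a : F) {v : ι → F} {B : Matrix ι ι F} (hB : B.IsSymm)
    (hv : v ∉ LinearMap.range B.mulVecLin) : (border a v B).rank = B.rank + 2 := by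
  classical
  rw [rank_border a v hB, if_neg hv, if_neg]
  rintro ⟨x, hx, -⟩
  exact hv ⟨x, hx⟩

/-- By symmetry of `B`, the value `x ⬝ᵥ B *ᵥ x` depends only on `B *ᵥ x`, so exactly one corner
entry preserves the rank. -/
theorem rank_border_mulVec [DecidableEq F] (a : F) (x : ι → F) {B : Matrix ι ι F}
    (hB : B.IsSymm) : (border a (B *ᵥ x) B).rank =
      B.rank + if a = x ⬝ᵥ B *ᵥ x then 0 else 1 := by
  classical
  rw [rank_border a _ hB, if_pos ⟨x, rfl⟩, add_zero]
  congr 2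
  refine propext ⟨?_, fun h => ⟨x, rfl, h.symm⟩⟩
  rintro ⟨y, hy, rfl⟩
  rw [dotProduct_mulVec, dotProduct_mulVec, ← mulVec_transpose, ← mulVec_transpose, hB.eq, hy]

/-- Elimination with the pivot `a`. -/
theorem rank_border_add_vecMulVec {a : F} (ha : a ≠ 0) (v : ι → F) {C : Matrix ι ι F}
    (hC : C.IsSymm) : (border a v (C + a⁻¹ • vecMulVec v v)).rank = C.rank + 1 := by
  classical
  set P : Matrix (Unit ⊕ ι) (Unit ⊕ ι) F := fromBlocks 1 0 (of fun i _ => a⁻¹ * v i) 1 with hP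
  have hdet : IsUnit P.det := by simp [hP]
  have hdet' : IsUnit Pᵀ.det := by rwa [det_transpose]
  have hmul : border a v (C + a⁻¹ • vecMulVec v v) = P * border a 0 C * Pᵀ := by
    rw [hP, border, border, fromBlocks_transpose, fromBlocks_multiply, fromBlocks_multiply]
    congr 1 <;> ext i j <;> simp [mul_apply, vecMulVec_apply]
    · field_simp
    · field_simp
    · field_simp
      ring
  rw [hmul, rank_mul_eq_left_of_isUnit_det _ _ hdet', rank_mul_eq_right_of_isUnit_det _ _ hdet]
  have h := rank_border_mulVec a 0 hC
  rwa [mulVec_zero, dotProduct_zero, if_neg ha] at h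

end Border

/-! ### Counting symmetric matrices by rank. -/

section Counting

variable {ι F : Type*} [Field F]

variable (ι F) in
/-- The type of symmetric matrices. -/
abbrev SymmMatrix : Type _ := {B : Matrix ι ι F // B.IsSymm}

/-- A symmetric matrix is made up of a corner entry, the rest of its first row, and a symmetric
block. -/
def borderEquiv : SymmMatrix ι F × (ι → F) × F ≃ SymmMatrix (Unit ⊕ ι) F where
  toFun p := ⟨border p.2.2 p.2.1 p.1.1, IsSymm.ext (by
    rintro (i | i) (j | j)
    · rfl
    · rfl
    · rfl
    · exact p.1.2.apply i j)⟩
  invFun A := ⟨⟨A.1.toBlocks₂₂, IsSymm.ext fun i j => A.2.apply _ _⟩,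
    fun j => A.1 (Sum.inl ()) (Sum.inr j), A.1 (Sum.inl ()) (Sum.inl ())⟩
  left_inv p := rfl
  right_inv A := by
    ext (i | i) (j | j)
    · rfl
    · rfl
    · exact A.2.apply _ _
    · rfl

/-- `Fin (n + 1)` with its first element split off. -/
def unitSumFinEquiv (n : ℕ) : Unit ⊕ Fin n ≃ Fin (n + 1) where
  toFun := Sum.elim (fun _ => 0) Fin.succ
  invFun := Fin.cases (Sum.inl ()) Sum.inr
  left_inv := by rintro (i | i) <;> rfl
  right_inv i := by cases i using Fin.cases <;> rfl

/-- Relabelling the rows and columns of symmetric matrices. -/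
def reindexSymm {κ : Type*} (e : ι ≃ κ) : SymmMatrix ι F ≃ SymmMatrix κ F where
  toFun A := ⟨reindex e e A.1, IsSymm.ext fun i j => A.2.apply _ _⟩
  invFun A := ⟨reindex e.symm e.symm A.1, IsSymm.ext fun i j => A.2.apply _ _⟩
  left_inv A := by ext i j; simp
  right_inv A := by ext i j; simp

open scoped Classical

variable [Fintype F]

theorem sum_symmMatrix_succ {M : Type*} [AddCommMonoid M] (n : ℕ) (f : F → ℕ → M) :
    ∑ A : SymmMatrix (Fin (n + 1)) F, f (A.1 0 0) A.1.rank =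
      ∑ B : SymmMatrix (Fin n) F, ∑ v : Fin n → F, ∑ a : F, f a (border a v B.1).rank := by
  rw [← (borderEquiv.trans (reindexSymm (unitSumFinEquiv n))).sum_comp, Fintype.sum_prod_type]
  refine Finset.sum_congr rfl fun B _ => ?_
  rw [Fintype.sum_prod_type]
  refine Finset.sum_congr rfl fun v _ => Finset.sum_congr rfl fun a _ => ?_
  congr 1
  exact rank_reindex _ _ _

theorem ncard_symm (n : ℕ) (p : Matrix (Fin n) (Fin n) F → Prop) [DecidablePred p] :
    ({A | A.IsSymm ∧ p A}.ncard : ℚ) = ∑ A : SymmMatrix (Fin n) F, if p A.1 then 1 else 0 := by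
  have h : {A | A.IsSymm ∧ p A} = Subtype.val '' {A : SymmMatrix (Fin n) F | p A.1} := by
    ext A
    simp [and_comm]
  rw [h, Set.ncard_image_of_injective _ Subtype.val_injective, Set.ncard_eq_toFinset_card',
    Finset.sum_boole]
  congr 2
  ext A
  simp

theorem s_eq_sum (r : ℤ) (n : ℕ) :
    (s F r n : ℚ) = ∑ A : SymmMatrix (Fin n) F, if (A.1.rank : ℤ) = r then 1 else 0 :=
  ncard_symm n _

theorem nS_eq_sum (r : ℤ) (n : ℕ) :
    (nS F r n : ℚ) = ∑ A : SymmMatrix (Fin n) F, if (A.1.rank : ℤ) ≤ r then 1 else 0 :=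
  ncard_symm n _

theorem nS_sub_one_add_s (r : ℤ) (n : ℕ) : (nS F (r - 1) n : ℚ) + s F r n = nS F r n := by
  rw [s_eq_sum, nS_eq_sum, nS_eq_sum, ← Finset.sum_add_distrib]
  refine Finset.sum_congr rfl fun A _ => ?_
  split_ifs <;> first | omega | norm_num

theorem s_zero (r : ℤ) : s F r 0 = if r = 0 then 1 else 0 := by
  have h := s_eq_sum (F := F) r 0
  have hS : Unique (SymmMatrix (Fin 0) F) := ⟨⟨⟨0, isSymm_zero⟩⟩, fun A => Subsingleton.elim _ _⟩
  rw [Fintype.sum_unique] at h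
  have h0 : (default : SymmMatrix (Fin 0) F).1.rank = 0 :=
    Nat.le_zero.1 (by simpa using rank_le_width (default : SymmMatrix (Fin 0) F).1)
  rw [h0] at h
  have : (s F r 0 : ℚ) = (if r = 0 then 1 else 0 : ℕ) := by
    rw [h]
    split_ifs <;> first | omega | norm_num
  exact_mod_cast this

theorem sum_translate {M : Type*} [AddCommMonoid M] {n : ℕ} (D : Matrix (Fin n) (Fin n) F)
    (hD : D.IsSymm) (f : Matrix (Fin n) (Fin n) F → M) :
    ∑ B : SymmMatrix (Fin n) F, f B.1 = ∑ C : SymmMatrix (Fin n) F, f (C.1 + D) := by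
  let e : SymmMatrix (Fin n) F ≃ SymmMatrix (Fin n) F :=
    { toFun := fun C => ⟨C.1 + D, C.2.add hD⟩
      invFun := fun C => ⟨C.1 - D, C.2.sub hD⟩
      left_inv := fun C => by simp
      right_inv := fun C => by simp }
  exact (e.sum_comp fun B => f B.1).symm

/-- The number of symmetric matrices of rank at most `t` with nonzero corner entry. -/
theorem sum_corner_ne_zero (t : ℤ) (n : ℕ) :
    (∑ A : SymmMatrix (Fin (n + 1)) F, if (A.1.rank : ℤ) ≤ t ∧ A.1 0 0 ≠ 0 then (1 : ℚ) else 0) =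
      ((Fintype.card F : ℚ) - 1) * (Fintype.card F : ℚ) ^ n * nS F (t - 1) n := by
  rw [sum_symmMatrix_succ n (fun a k => if (k : ℤ) ≤ t ∧ a ≠ 0 then (1 : ℚ) else 0),
    Finset.sum_comm]
  -- For fixed `v` and `a ≠ 0`, the Schur complement `C = B - a⁻¹ v vᵀ` runs over all symmetric
  -- matrices as `B` does.
  have key : ∀ (v : Fin n → F) (a : F), (∑ B : SymmMatrix (Fin n) F,
      if ((border a v B.1).rank : ℤ) ≤ t ∧ a ≠ 0 then (1 : ℚ) else 0) =
        if a ≠ 0 then (nS F (t - 1) n : ℚ) else 0 := by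
    intro v a
    by_cases ha : a = 0
    · simp [ha]
    rw [if_pos ha, nS_eq_sum, sum_translate (a⁻¹ • vecMulVec v v)
      (IsSymm.ext fun i j => by simp [vecMulVec_apply, mul_comm])
      (fun B => if ((border a v B).rank : ℤ) ≤ t ∧ a ≠ 0 then (1 : ℚ) else 0)]
    refine Finset.sum_congr rfl fun C _ => ?_
    rw [rank_border_add_vecMulVec ha v C.2]
    refine if_congr ?_ rfl rfl
    push_cast
    constructor
    · rintro ⟨h, -⟩
      omega
    · exact fun h => ⟨by omega, ha⟩
  rw [Finset.sum_congr rfl fun v _ => Finset.sum_comm]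
  simp_rw [key]
  have hcard : ((Finset.univ.filter fun a : F => a ≠ 0).card : ℚ) = (Fintype.card F : ℚ) - 1 := by
    rw [Finset.filter_ne', Finset.card_erase_of_mem (Finset.mem_univ _), Finset.card_univ,
      Nat.cast_sub Fintype.card_pos, Nat.cast_one]
  rw [← Finset.sum_filter, Finset.sum_const, Finset.sum_const, nsmul_eq_mul, nsmul_eq_mul, hcard,
    Finset.card_univ, Fintype.card_fun, Fintype.card_fin]
  push_cast
  ring

/-- If `B` has rank `k`, its range has `q ^ k` elements. Each `v` in it has one `a` keeping the rank
and `q - 1` raising it by one; each of the other `q ^ n - q ^ k` vectors raises it by two for every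
`a`. -/
theorem sum_border_rank_eq (r : ℤ) {n : ℕ} (B : SymmMatrix (Fin n) F) :
    (∑ v : Fin n → F, ∑ a : F, if ((border a v B.1).rank : ℤ) = r then (1 : ℚ) else 0) =
      (Fintype.card F : ℚ) ^ r * (if (B.1.rank : ℤ) = r then 1 else 0) +
      ((Fintype.card F : ℚ) - 1) * (Fintype.card F : ℚ) ^ (r - 1) *
        (if (B.1.rank : ℤ) = r - 1 then 1 else 0) +
      ((Fintype.card F : ℚ) ^ (n + 1) - (Fintype.card F : ℚ) ^ (r - 1)) *
        (if (B.1.rank : ℤ) = r - 2 then 1 else 0) := by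
  have hq : (Fintype.card F : ℚ) ≠ 0 := by exact_mod_cast Fintype.card_ne_zero
  have key : ∀ v : Fin n → F,
      (∑ a : F, if ((border a v B.1).rank : ℤ) = r then (1 : ℚ) else 0) =
        if v ∈ LinearMap.range B.1.mulVecLin then
          (if (B.1.rank : ℤ) = r then 1 else 0) +
            ((Fintype.card F : ℚ) - 1) * (if (B.1.rank : ℤ) = r - 1 then 1 else 0)
        else (Fintype.card F : ℚ) * (if (B.1.rank : ℤ) = r - 2 then 1 else 0) := by
    intro v
    by_cases hv : v ∈ LinearMap.range B.1.mulVecLin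
    · rw [if_pos hv]
      obtain ⟨x, rfl⟩ := hv
      have hsplit : ∀ a : F,
          (if ((border a (B.1.mulVecLin x) B.1).rank : ℤ) = r then (1 : ℚ) else 0) =
            (if (B.1.rank : ℤ) = r - 1 then 1 else 0) + if a = x ⬝ᵥ B.1 *ᵥ x then
              (if (B.1.rank : ℤ) = r then 1 else 0) - (if (B.1.rank : ℤ) = r - 1 then 1 else 0)
            else 0 := by
        intro a
        rw [mulVecLin_apply, rank_border_mulVec a x B.2]
        by_cases ha : a = x ⬝ᵥ B.1 *ᵥ x
        · simp [if_pos ha]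
        · rw [if_neg ha, if_neg ha, add_zero]
          exact if_congr (by push_cast; omega) rfl rfl
      rw [Finset.sum_congr rfl fun a _ => hsplit a, Finset.sum_add_distrib, Finset.sum_const,
        Finset.sum_ite_eq' Finset.univ, if_pos (Finset.mem_univ _), Finset.card_univ, nsmul_eq_mul]
      split_ifs <;> first | omega | ring
    · simp_rw [if_neg hv, rank_border_of_notMem _ B.2 hv]
      rw [Finset.sum_const, Finset.card_univ, nsmul_eq_mul]
      congr 1
      exact if_congr (by push_cast; omega) rfl rfl
  have hrange : ((Finset.univ.filter fun v => v ∈ LinearMap.range B.1.mulVecLin).card : ℚ) =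
      (Fintype.card F : ℚ) ^ B.1.rank := by
    rw [← Fintype.card_subtype]
    have := Module.card_eq_pow_finrank (K := F) (V := LinearMap.range B.1.mulVecLin)
    rw [Matrix.rank, ← Nat.cast_pow, ← this]
  have hcompl : ((Finset.univ.filter fun v => ¬ v ∈ LinearMap.range B.1.mulVecLin).card : ℚ) =
      (Fintype.card F : ℚ) ^ n - (Fintype.card F : ℚ) ^ B.1.rank := by
    have h := Finset.card_filter_add_card_filter_not (s := Finset.univ)
      (fun v => v ∈ LinearMap.range B.1.mulVecLin)
    rw [Finset.card_univ, Fintype.card_fun, Fintype.card_fin] at h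
    have h' := congrArg (Nat.cast : ℕ → ℚ) h
    push_cast at h'
    rw [hrange] at h'
    linarith
  rw [Finset.sum_congr rfl fun v _ => key v, Finset.sum_ite, Finset.sum_const, Finset.sum_const,
    nsmul_eq_mul, nsmul_eq_mul, hrange, hcompl, ← zpow_natCast _ B.1.rank]
  by_cases h0 : (B.1.rank : ℤ) = r
  · rw [if_pos h0, if_neg (by omega), if_neg (by omega), h0]
    ring
  by_cases h1 : (B.1.rank : ℤ) = r - 1
  · rw [if_neg h0, if_pos h1, if_neg (by omega), h1]
    ring
  by_cases h2 : (B.1.rank : ℤ) = r - 2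
  · rw [if_neg h0, if_neg h1, if_pos h2, h2, show r - 1 = r - 2 + 1 by ring,
      zpow_add_one₀ hq (r - 2)]
    ring
  · rw [if_neg h0, if_neg h1, if_neg h2]
    ring

theorem s_succ (r : ℤ) (n : ℕ) :
    (s F r (n + 1) : ℚ) = (Fintype.card F : ℚ) ^ r * s F r n +
      ((Fintype.card F : ℚ) - 1) * (Fintype.card F : ℚ) ^ (r - 1) * s F (r - 1) n +
      ((Fintype.card F : ℚ) ^ (n + 1) - (Fintype.card F : ℚ) ^ (r - 1)) * s F (r - 2) n := by
  simp only [s_eq_sum]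
  rw [sum_symmMatrix_succ n (fun _ k => if (k : ℤ) = r then (1 : ℚ) else 0),
    Finset.sum_congr rfl fun B _ => sum_border_rank_eq r B, Finset.sum_add_distrib,
    Finset.sum_add_distrib, ← Finset.mul_sum, ← Finset.mul_sum, ← Finset.mul_sum]

/-- The case `t` for `n + 1` uses the cases `t`, `t - 1`, `t - 2` for `n`; letting `t` range over
all integers avoids boundary cases. For `n = 0`, `t = 0` the correction `q⁻¹` is what makes the
right side vanish. -/
theorem s_ratio (n : ℕ) (t : ℤ) :
    ((Fintype.card F : ℚ) ^ n - (Fintype.card F : ℚ) ^ (t - 1)) * s F (t - 1) n =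
      ((Fintype.card F : ℚ) ^ (t - 1) - if Even t then (Fintype.card F : ℚ)⁻¹ else 0) *
        s F t n := by
  have hq : (Fintype.card F : ℚ) ≠ 0 := by exact_mod_cast Fintype.card_ne_zero
  induction n generalizing t with
  | zero =>
    rw [s_zero, s_zero]
    by_cases h0 : t = 0
    · subst h0
      simp
    by_cases h1 : t = 1
    · subst h1
      simp
    · rw [if_neg (by omega), if_neg h0]
      simp
  | succ n ih =>
    have e0 := ih t
    have e1 := ih (t - 1)
    have e2 := ih (t - 2)
    rw [s_succ, s_succ, show t - 1 - 2 = t - 2 - 1 by ring]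
    rw [show t - 1 - 1 = t - 2 by ring] at e1 ⊢
    have z1 : (Fintype.card F : ℚ) ^ (t - 1) = (Fintype.card F : ℚ) ^ t / Fintype.card F := by
      rw [zpow_sub_one₀ hq, div_eq_mul_inv]
    have z2 : (Fintype.card F : ℚ) ^ (t - 2) =
        (Fintype.card F : ℚ) ^ t / (Fintype.card F : ℚ) ^ 2 := zpow_sub₀ hq t 2
    have z3 : (Fintype.card F : ℚ) ^ (t - 2 - 1) =
        (Fintype.card F : ℚ) ^ t / (Fintype.card F : ℚ) ^ 3 := by
      rw [sub_sub]
      exact zpow_sub₀ hq t 3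
    rw [z1] at e0 ⊢
    rw [z2] at e1 ⊢
    rw [z3] at e2
    generalize (Fintype.card F : ℚ) ^ t = T at *
    generalize (Fintype.card F : ℚ) = q at *
    generalize (s F t n : ℚ) = x0 at *
    generalize (s F (t - 1) n : ℚ) = x1 at *
    generalize (s F (t - 2) n : ℚ) = x2 at *
    generalize (s F (t - 2 - 1) n : ℚ) = x3 at *
    by_cases ht : Even t
    · rw [if_pos ht] at e0 ⊢
      -- The coefficients of `e0` and `e2` are forced by the terms in `x0` and `x3`. What remains in
      -- `x1` and `x2` is `-(q - 1)` times `e1` for even `t`, and cancels for odd `t`.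
      rw [if_neg (by rw [Int.even_sub_one]; exact not_not.2 ht)] at e1
      rw [if_pos (ht.sub even_two)] at e2
      linear_combination (norm := (field_simp; ring)) T * e0 - (q - 1) * e1 + q * (q ^ (n + 1) - T / q) * e2
    · rw [if_neg ht] at e0 ⊢
      rw [if_pos (Int.even_sub_one.2 ht)] at e1
      rw [if_neg (by rwa [Int.even_sub, iff_true_right even_two])] at e2
      linear_combination (norm := (field_simp; ring)) T * e0 + q * (q ^ (n + 1) - T / q) * e2

/-! ### The weight of the codeword. -/

theorem W_one_eq_nS (t : ℤ) (n : ℕ) {δ : F} (hδ : δ ≠ 0) :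
    (W 1 δ t (n + 1) : ℚ) =
      ((Fintype.card F : ℚ) - 1) * (Fintype.card F : ℚ) ^ n * nS F (t - 1) n := by
  have heval : ∀ A : Matrix (Fin (n + 1)) (Fin (n + 1)) F,
      MvPolynomial.eval (fun p : Fin (n + 1) × Fin (n + 1) => A p.1 p.2)
        (diagForm 1 δ (n + 1)).1 = δ * A 0 0 := by
    intro A
    simp [diagForm, diagPoly]
  have hsupp : supp 1 δ t (n + 1) =
      {A : Matrix (Fin (n + 1)) (Fin (n + 1)) F |
        A.IsSymm ∧ ((A.rank : ℤ) ≤ t ∧ A 0 0 ≠ 0)} := by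
    ext A
    simp only [supp, rankLE, Set.mem_ofPred_eq, heval, mul_ne_zero_iff, and_assoc, ne_eq, hδ,
      not_false_eq_true, true_and]
  rw [W, hsupp]
  exact (ncard_symm (n + 1) fun A => (A.rank : ℤ) ≤ t ∧ A 0 0 ≠ 0).trans
    (by convert sum_corner_ne_zero t n)

/-- The weight of the codeword of `f_k^δ` is the cardinality of its support. -/
theorem hammingNorm_codeword [DecidableEq F] (k : ℕ) (δ : F) (t : ℤ) (m : ℕ) :
    hammingNorm (codeword k δ t m : rankLE F t m → F) = W k δ t m := by
  have h : supp k δ t m = Subtype.val ''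
      {A : rankLE F t m | (codeword k δ t m : rankLE F t m → F) A ≠ 0} := by
    ext A
    simp only [supp, Set.mem_ofPred_eq, Set.mem_image, Subtype.exists, exists_and_right,
      exists_eq_right]
    exact ⟨fun ⟨hA, hne⟩ => ⟨hA, hne⟩, fun ⟨hA, hne⟩ => ⟨hA, hne⟩⟩
  rw [W, h, Set.ncard_image_of_injective _ Subtype.val_injective, hammingNorm,
    Set.ncard_eq_toFinset_card', Set.toFinset_ofPred]

end Counting

end SymmDetCode

theorem mainTheorem4 {F : Type*} [Field F] [Fintype F] [DecidableEq F]
    (q : ℕ) (hq : Fintype.card F = q) (hodd : Odd q)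
    (t m : ℕ) (hm : 1 ≤ m) (htm : t ≤ m) (δ : F) (hδ : δ ≠ 0) :
    hammingNorm (SymmDetCode.codeword 1 δ t m : SymmDetCode.rankLE F t m → F)
        = SymmDetCode.W 1 δ t m ∧
    (Odd t →
      (SymmDetCode.W 1 δ t m : ℚ) =
        ((q : ℚ) - 1) * (q : ℚ) ^ (m - 1) * SymmDetCode.nS F ((t : ℤ) - 2) (m - 1)
        + ((q : ℚ) - 1) * (q : ℚ) ^ ((t : ℤ) - 1) * SymmDetCode.s F ((t : ℤ) - 1) (m - 1)
        + ((q : ℚ) - 1) * (q : ℚ) ^ ((t : ℤ) - 1) * SymmDetCode.s F (t : ℤ) (m - 1)) ∧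
    (Even t →
      (SymmDetCode.W 1 δ t m : ℚ) =
        ((q : ℚ) - 1) * (q : ℚ) ^ (m - 1) * SymmDetCode.nS F ((t : ℤ) - 2) (m - 1)
        + ((q : ℚ) - 1) * (q : ℚ) ^ ((t : ℤ) - 1) * SymmDetCode.s F ((t : ℤ) - 1) (m - 1)
        + ((q : ℚ) - 1) * ((q : ℚ) ^ ((t : ℤ) - 1) - (q : ℚ)⁻¹)
            * SymmDetCode.s F (t : ℤ) (m - 1)) := by
  obtain ⟨n, rfl⟩ := Nat.exists_eq_add_of_le' hm
  subst hq
  have hW := SymmDetCode.W_one_eq_nS t n hδ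
  have hn := SymmDetCode.nS_sub_one_add_s (F := F) ((t : ℤ) - 1) n
  rw [sub_sub, one_add_one_eq_two] at hn
  have hr := SymmDetCode.s_ratio (F := F) n t
  rw [Nat.add_sub_cancel]
  refine ⟨SymmDetCode.hammingNorm_codeword 1 δ t (n + 1), fun ht => ?_, fun ht => ?_⟩
  · rw [if_neg (by rwa [Int.even_coe_nat, Nat.not_even_iff_odd])] at hr
    rw [hW, ← hn]
    linear_combination ((Fintype.card F : ℚ) - 1) * hr
  · rw [if_pos ((Int.even_coe_nat t).2 ht)] at hr
    rw [hW, ← hn]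
    linear_combination ((Fintype.card F : ℚ) - 1) * hr
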